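/- **Theorem (Variance of the LPDE solution).** Let $\phi,\psi:\mathbb R\to\mathbb R$ be a bounded father and mother wavelet of a multiresolution analysis of $L^2(\mathbb R)$, and put $\phi^D_{0,k}(y)=\phi(y-k)$ and $\psi^D_{i,k}(y)=2^{i/2}\psi(2^iy-k)$ for $k\in\mathbb Z$, $i\ge 0$. Consider the linear PDE $$\frac{\partial Q}{\partial t}+\frac{\sigma^2(t,x)}{2}\frac{\partial^2Q}{\partial x^2}+\mu(t,x)\frac{\partial Q}{\partial x}=0\quad(t<0),\qquad Q(0,x)=f(x),$$ with measurable, locally bounded coefficients $\mu$, $\sigma$ (for instance $\mu=0$, $\sigma(t,x)=\sigma |x|^\lambda$, $\lambda \ge 0$). Its solution is understood through the Feynman–Kac formula $Q(t,x)=\mathbb E[f(X_0)\mid X_t=x]$, where $X$ is a weak solution (a solution of the martingale problem) on $[t,0]$ of $dX_s=\mu(s,X_s)\,ds+\sigma(s,X_s)\,dB_s$ started from $x$ at time $t\le 0$. The diffusionlets $\Phi^D_{0,k}(t,x)=\mathbb E[\phi^D_{0,k}(X_0)\mid X_t=x]$ and $\Psi^D_{i,k}(t,x)=\mathbb E[\psi^D_{i,k}(X_0)\mid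 X_t=x]$ are the solutions with the wavelets as terminal conditions. Let $(\Omega,\mathcal F,\mathbb P,\mathbb D,\Gamma)$ be an error structure: $(\Omega,\mathcal F,\mathbb P)$ is a probability space, $\mathbb D$ is a dense subspace of $L^2(\mathbb P)$, and $\Gamma:\mathbb D\times\mathbb D\to L^1(\mathbb P)$ (the carré du champ) is bilinear, symmetric and positive, satisfies $F(u),G(v)\in\mathbb D$ and $\Gamma[F(u),G(v)]=F'(u)G'(v)\Gamma[u,v]$ for all Lipschitz $C^1$ functions $F,G$ and all $u,v\in\mathbb D$, and makes $\mathbb D$ complete for the norm $(\|u\|_{L^2}^2+\mathbb E\,\Gamma[u,u])^{1/2}$. Write $\Gamma[u]=\Gamma[u,u]$. Let the random wavelet coefficients $\alpha_k$ ($k\in\mathbb Z$) and $\beta_{i,k}$ ($i\ge 0$, $k\in\mathbb Z$) belong to $\mathbb D$. Suppose that $\Gamma[a,b]=0$ for any two different coefficients $a,b$, and that there are constants $\gamma(k),\gamma(i,k)\in\mathbb R$ such that $$\Gamma[\alpha_k]=\gamma(k)\,\alpha_k^2,\qquad \Gamma[\beta_{i,k}]=\gamma(i,k)\,\beta_{i,k}^2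 .$$ 1. Let $f$ be a random terminal condition, almost surely in $L^2(\mathbb R)$, whose coefficients $\langle f,\phi^D_{0,k}\rangle$ and $\langle f,\psi^D_{i,k}\rangle$ are $\alpha_k$ and $\beta_{i,k}$, and let $\widetilde Q$ be the solution with terminal condition $f$. Let $t \le 0$ and $x$ be such that - $\mathbb E[g(X_0)\mid X_t=x]$ is well defined for every $g\in L^2(\mathbb R)$ (the expectation exists and does not depend on the representative of $g$), - $\widetilde Q(t,x)\in L^2(\mathbb P)$, and - $\sum_k\gamma(k)\,\mathbb E[\alpha_k^2]\,[\Phi^D_{0,k}(t,x)]^2+\sum_{i,k}\gamma(i,k)\,\mathbb E[\beta_{i,k}^2]\,[\Psi^D_{i,k}(t,x)]^2<\infty$. Then $\widetilde Q(t,x)\in\mathbb D$ and, almost surely, with convergent series, $$\Gamma\big[\widetilde Q(t,x)\big]=\sum_k\gamma(k)\,\alpha_k^2\,\big[\Phi^D_{0,k}(t,x)\big]^2+\sum_i\sum_k\gamma(i,k)\,\beta_{i,k}^2\,\big[\Psi^D_{i,k}(t,x)\big]^2 .$$ 2. If instead $f$ is a truncated expansion, that is, a finite sum of terms $\alpha_k\phi^D_{0,k}$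 and $\beta_{i,k}\psi^D_{i,k}$, then for every $t\le 0$ and every $x$ the solution with terminal condition $f$ satisfies $\widetilde Q(t,x)\in\mathbb D$ and the same formula, with the sums restricted to the terms present. -/

import Mathlib

open MeasureTheory Filter Topology

/-! ### Error structures -/

/-- An error structure `(Ω, 𝓕, P, 𝔻, Γ)`: `𝔻` is a dense subspace of `L²(P)`, and `Γ` (the carré
du champ) is a symmetric positive bilinear map `𝔻 × 𝔻 → L¹(P)` satisfying the functional calculus
`Γ[F(u), G(v)] = F'(u) G'(v) Γ[u, v]` for Lipschitz `C¹` functions `F`, `G`, such that `𝔻` is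
complete for the norm whose square is `‖u‖²_{L²} + 𝔼[Γ[u, u]]`. -/
structure ErrorStructure {Ω : Type*} [MeasurableSpace Ω] (P : Measure Ω)
    [IsProbabilityMeasure P] where
  /-- the domain `𝔻` -/
  domain : Submodule ℝ (Lp ℝ 2 P)
  dense_domain : Dense (domain : Set (Lp ℝ 2 P))
  /-- the carré du champ -/
  Γ : domain →ₗ[ℝ] domain →ₗ[ℝ] Lp ℝ 1 P
  Γ_symm : ∀ u v : domain, Γ u v = Γ v u
  Γ_nonneg : ∀ u : domain, 0 ≤ᵐ[P] (Γ u u : Ω → ℝ)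
  chain_rule : ∀ F G : ℝ → ℝ, ContDiff ℝ 1 F → ContDiff ℝ 1 G →
    (∃ K, LipschitzWith K F) → (∃ K, LipschitzWith K G) → ∀ u v : domain,
      ∃ Fu Gv : domain,
        ((Fu : Lp ℝ 2 P) : Ω → ℝ) =ᵐ[P] (fun ω => F ((u : Lp ℝ 2 P) ω)) ∧
        ((Gv : Lp ℝ 2 P) : Ω → ℝ) =ᵐ[P] (fun ω => G ((v : Lp ℝ 2 P) ω)) ∧
        (Γ Fu Gv : Ω → ℝ) =ᵐ[P]
          (fun ω => deriv F ((u : Lp ℝ 2 P) ω) * deriv G ((v : Lp ℝ 2 P) ω) * Γ u v ω)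
  complete : ∀ u : ℕ → domain,
    (∀ ε : ℝ, 0 < ε → ∃ N, ∀ m, N ≤ m → ∀ n, N ≤ n →
      ‖u m - u n‖ ^ 2 + ∫ ω, Γ (u m - u n) (u m - u n) ω ∂P < ε) →
    ∃ v : domain,
      Tendsto (fun n => ‖u n - v‖ ^ 2 + ∫ ω, Γ (u n - v) (u n - v) ω ∂P) atTop (𝓝 0)

/-! ### Wavelets -/

/-- The dilated and translated function `η_{i,k}(y) = 2^{i/2} η(2^i y - k)`. -/
noncomputable def dilate (η : ℝ → ℝ) (i k : ℤ) : ℝ → ℝ :=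
  fun y => (2 : ℝ) ^ ((i : ℝ) / 2) * η ((2 : ℝ) ^ i * y - k)

/-- The closed subspace of `L²(ℝ)` spanned by the functions `η_{i,k}`, `k ∈ ℤ`. For the father
wavelet `φ` this is the space `V_i`. -/
noncomputable def scaleSpace (η : ℝ → ℝ) (i : ℤ) : Submodule ℝ (Lp ℝ 2 (volume : Measure ℝ)) :=
  (Submodule.span ℝ {u : Lp ℝ 2 (volume : Measure ℝ) |
    ∃ k : ℤ, (u : ℝ → ℝ) =ᵐ[volume] dilate η i k}).topologicalClosure

/-- `φ` is the (bounded) father wavelet of a multiresolution analysis `(V_i)` of `L²(ℝ)` and `ψ` is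
a (bounded) mother wavelet for it: for each `i`, the functions `ψ_{i,k}` form an orthonormal basis
of the orthogonal complement `W_i` of `V_i` in `V_{i+1}`. -/
structure IsWaveletSystem (φ ψ : ℝ → ℝ) : Prop where
  memLp_father : MemLp φ 2 volume
  memLp_mother : MemLp ψ 2 volume
  measurable_father : Measurable φ
  measurable_mother : Measurable ψ
  bounded_father : ∃ C, ∀ y, |φ y| ≤ C
  bounded_mother : ∃ C, ∀ y, |ψ y| ≤ C
  orthonormal_father : ∀ k l : ℤ, ∫ y, dilate φ 0 k y * dilate φ 0 l y = if k = l then 1 else 0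
  nested : ∀ i : ℤ, scaleSpace φ i ≤ scaleSpace φ (i + 1)
  dense_iUnion : Dense (⋃ i : ℤ, (scaleSpace φ i : Set (Lp ℝ 2 (volume : Measure ℝ))))
  orthonormal_mother : ∀ i k l : ℤ,
    ∫ y, dilate ψ i k y * dilate ψ i l y = if k = l then 1 else 0
  scaleSpace_mother : ∀ i : ℤ, scaleSpace ψ i = (scaleSpace φ i)ᗮ ⊓ scaleSpace φ (i + 1)

/-- Index set of the wavelet basis: `Sum.inl k` stands for `φ_{0,k}`, and `Sum.inr (i, k)` stands
for `ψ_{i,k}`, `i ≥ 0`. -/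
abbrev WaveletIndex : Type := ℤ ⊕ (ℕ × ℤ)

/-- The elements `φ_{0,k}` and `ψ_{i,k}` of the wavelet basis. -/
noncomputable def wavelet (φ ψ : ℝ → ℝ) : WaveletIndex → ℝ → ℝ
  | Sum.inl k => dilate φ 0 k
  | Sum.inr (i, k) => dilate ψ i k

/-! ### Linear partial differential equations with terminal condition at time `0` -/

/-- The coefficients `μ`, `σ` of the equation
`∂Q/∂t + (σ²/2) ∂²Q/∂x² + μ ∂Q/∂x = 0` for `t < 0`, with terminal condition at time `0`, both as
functions of `(t, x)`. -/
structure LPDE where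
  /-- the drift `μ` -/
  drift : ℝ → ℝ → ℝ
  /-- the volatility `σ` -/
  vol : ℝ → ℝ → ℝ
  measurable_drift : Measurable (Function.uncurry drift)
  measurable_vol : Measurable (Function.uncurry vol)
  locally_bounded : ∀ R : ℝ, ∃ C : ℝ, ∀ t x : ℝ, -R ≤ t → t ≤ 0 → |x| ≤ R →
    |drift t x| ≤ C ∧ |vol t x| ≤ C

/-- The spatial operator `(σ²/2) g'' + μ g'` of the equation, at time `s` and place `y`. -/
noncomputable def LPDE.generator (E : LPDE) (g : ℝ → ℝ) (s y : ℝ) : ℝ :=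
  E.vol s y ^ 2 / 2 * iteratedDeriv 2 g y + E.drift s y * deriv g y

/-- Under `W`, the process `X` on `[t, 0]` is a (weak) solution of
`dX_s = μ(s, X_s) ds + σ(s, X_s) dB_s` with `X_t = x`, in the sense of the martingale problem. -/
structure IsDiffusionFrom (E : LPDE) (t x : ℝ) {Ω' : Type*} [MeasurableSpace Ω']
    (W : Measure Ω') (X : ℝ → Ω' → ℝ) : Prop where
  isProbabilityMeasure : IsProbabilityMeasure W
  measurable : ∀ s ∈ Set.Icc t 0, Measurable (X s)
  continuousOn : ∀ᵐ ω ∂W, ContinuousOn (fun s => X s ω) (Set.Icc t 0)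
  start : ∀ᵐ ω ∂W, X t ω = x
  martingale : ∃ 𝓕 : Filtration (Set.Icc t 0) (inferInstance : MeasurableSpace Ω'),
    (∀ s : Set.Icc t 0, Measurable[𝓕 s] (X s)) ∧
    ∀ g : ℝ → ℝ, ContDiff ℝ ((⊤ : ℕ∞) : WithTop ℕ∞) g → HasCompactSupport g →
      Martingale (fun (s : Set.Icc t 0) ω =>
        g (X s ω) - ∫ u in t..(s : ℝ), E.generator g u (X u ω)) 𝓕 W

/-- The solution of the equation with terminal condition `g`, at the starting point `(t, x)` of the
diffusion `X`: the Feynman-Kac expectation `Q(t, x) = 𝔼[g(X_0) | X_t = x]`. -/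
noncomputable def lpdeSolution {Ω' : Type*} [MeasurableSpace Ω'] (W : Measure Ω')
    (X : ℝ → Ω' → ℝ) (g : ℝ → ℝ) : ℝ :=
  ∫ ω, g (X 0 ω) ∂W

/-- The diffusionlets `Φ_{0,k}(t, x)` and `Ψ_{i,k}(t, x)`: the solutions of the equation with the
wavelets as terminal conditions. -/
noncomputable def diffusionlet {Ω' : Type*} [MeasurableSpace Ω'] (W : Measure Ω')
    (X : ℝ → Ω' → ℝ) (φ ψ : ℝ → ℝ) (n : WaveletIndex) : ℝ :=
  lpdeSolution W X (wavelet φ ψ n)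

/-- `𝔼[g(X_0) | X_t = x]` is well defined for every `g` in `L²(ℝ)`: it does not depend on the
representative of `g`, and the expectation exists. -/
def SolvableInL2 {Ω' : Type*} [MeasurableSpace Ω'] (W : Measure Ω') (X : ℝ → Ω' → ℝ) : Prop :=
  (∀ g h : ℝ → ℝ, g =ᵐ[volume] h → (fun ω => g (X 0 ω)) =ᵐ[W] (fun ω => h (X 0 ω))) ∧
  ∀ g : ℝ → ℝ, MemLp g 2 volume → Integrable (fun ω => g (X 0 ω)) W

/-! ### Convergence in `L²` -/

/-! For a fixed starting point, g ↦ 𝔼[g(X_0)] is a continuous linear functional on L²(ℝ), by the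
closed graph theorem (`SolvableInL2.continuous_compMap`). Applied to the orthonormal wavelet
expansion of f, it gives Q = ∑ a_n d_n almost surely, where the d_n are the diffusionlets
(`hasSum_lpdeSolution`). Cross terms vanish, so a partial sum S_N has Γ[S_N] = ∑ γ_n a_n² d_n².

The series is only known to converge almost surely, not in L²(P), so completeness of 𝔻 does not
apply directly. The energies 𝔼 Γ[S_N] are bounded, however, and a bounded smooth truncation does not
increase energy. The truncated S_N converge in L² by dominated convergence, limits of bounded energy
stay in 𝔻 (`mem_domain_of_approx`), and then the truncation is removed (`mem_domain_of_tendsto_ae`).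
Thus Q ∈ 𝔻, with energy at most the sum of the energies of the terms. The same bound for the tails Q
- S_N gives Γ[S_N] → Γ[Q] in L¹, and nonnegativity of the terms turns this into almost sure
convergence. -/

theorem norm_sq_Lp_two_eq_integral {α : Type*} [MeasurableSpace α] {P : Measure α}
    (v : Lp ℝ 2 P) : ‖v‖ ^ 2 = ∫ ω, (v ω) ^ 2 ∂P := by
  rw [← real_inner_self_eq_norm_sq, L2.inner_def]
  refine integral_congr_ae (Eventually.of_forall fun ω => ?_)
  simp [sq]

/-- Dominated convergence in `L²`. -/
theorem tendsto_Lp_two_of_dominated {α : Type*} [MeasurableSpace α] {P : Measure α}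
    {u : ℕ → Lp ℝ 2 P} {v : Lp ℝ 2 P} {g : α → ℝ} (hg : MemLp g 2 P)
    (hb : ∀ n, ∀ᵐ ω ∂P, |u n ω| ≤ g ω)
    (hlim : ∀ᵐ ω ∂P, Tendsto (fun n => u n ω) atTop (𝓝 (v ω))) :
    Tendsto u atTop (𝓝 v) := by
  have key : Tendsto (fun n => ‖u n - v‖ ^ 2) atTop (𝓝 0) := by
    have h : Tendsto (fun n => ∫ ω, (u n ω - v ω) ^ 2 ∂P) atTop (𝓝 (∫ _, (0 : ℝ) ∂P)) := by
      refine tendsto_integral_of_dominated_convergence (fun ω => 4 * g ω ^ 2)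
        (fun n => ?_) (hg.integrable_sq.const_mul 4) (fun n => ?_) ?_
      · exact ((Lp.aestronglyMeasurable _).sub (Lp.aestronglyMeasurable _)).pow 2
      · filter_upwards [ae_all_iff.2 hb, hlim] with ω h1 h2
        have h3 : |v ω| ≤ g ω := le_of_tendsto' h2.abs h1
        have h4 : |u n ω - v ω| ≤ 2 * g ω := (abs_sub _ _).trans (by linarith [h1 n])
        rw [Real.norm_eq_abs, abs_pow]
        calc |u n ω - v ω| ^ 2 ≤ (2 * g ω) ^ 2 := pow_le_pow_left₀ (abs_nonneg _) h4 2
          _ = 4 * g ω ^ 2 := by ring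
      · filter_upwards [hlim] with ω h
        have := (h.sub_const (v ω)).pow 2
        simpa using this
    rw [integral_zero] at h
    refine h.congr fun n => ?_
    rw [norm_sq_Lp_two_eq_integral]
    refine integral_congr_ae ?_
    filter_upwards [Lp.coeFn_sub (u n) v] with ω h
    rw [h, Pi.sub_apply]
  rw [tendsto_iff_norm_sub_tendsto_zero]
  have := key.sqrt
  simpa using this

/-! ### A smooth truncation -/

/-- The truncation `y ↦ (n + 1) arctan (y / (n + 1))`. -/
noncomputable def arctanTrunc (n : ℕ) (y : ℝ) : ℝ := (n + 1) * Real.arctan (y / (n + 1))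

theorem hasDerivAt_arctanTrunc (n : ℕ) (y : ℝ) :
    HasDerivAt (arctanTrunc n) (1 / (1 + (y / (n + 1)) ^ 2)) y := by
  have hn : (n + 1 : ℝ) ≠ 0 := by positivity
  have := (((hasDerivAt_id y).div_const (n + 1 : ℝ)).arctan).const_mul (n + 1 : ℝ)
  refine this.congr_deriv ?_
  rw [id, mul_comm, mul_assoc, one_div_mul_cancel hn, mul_one]

theorem contDiff_arctanTrunc (n : ℕ) : ContDiff ℝ 1 (arctanTrunc n) :=
  contDiff_const.mul (Real.contDiff_arctan.comp (contDiff_id.div_const _))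

/-- Through the chain rule, this bound is what keeps truncation from increasing the energy. -/
theorem abs_deriv_arctanTrunc_le (n : ℕ) (y : ℝ) : |deriv (arctanTrunc n) y| ≤ 1 := by
  rw [(hasDerivAt_arctanTrunc n y).deriv, abs_of_nonneg (by positivity)]
  rw [div_le_one (by positivity)]
  linarith [sq_nonneg (y / (n + 1))]

theorem lipschitzWith_arctanTrunc (n : ℕ) : LipschitzWith 1 (arctanTrunc n) :=
  lipschitzWith_of_nnnorm_deriv_le (fun y => (hasDerivAt_arctanTrunc n y).differentiableAt)
    fun y => by
      rw [← NNReal.coe_le_coe]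
      simpa using abs_deriv_arctanTrunc_le n y

theorem abs_arctanTrunc_le (n : ℕ) (y : ℝ) : |arctanTrunc n y| ≤ |y| := by
  have := (lipschitzWith_arctanTrunc n).dist_le_mul y 0
  simpa [Real.dist_eq, arctanTrunc] using this

theorem abs_arctanTrunc_le_const (n : ℕ) (y : ℝ) :
    |arctanTrunc n y| ≤ (n + 1) * (Real.pi / 2) := by
  rw [arctanTrunc, abs_mul, abs_of_pos (by positivity : (0 : ℝ) < n + 1)]
  gcongr
  exact abs_le.2 ⟨(Real.neg_pi_div_two_lt_arctan _).le, (Real.arctan_lt_pi_div_two _).le⟩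

theorem tendsto_arctanTrunc (y : ℝ) : Tendsto (fun n => arctanTrunc n y) atTop (𝓝 y) := by
  have h0 : Tendsto (fun n : ℕ => y / ((n : ℝ) + 1)) atTop (𝓝 0) := by
    have := (tendsto_one_div_add_atTop_nhds_zero_nat (𝕜 := ℝ)).const_mul y
    simpa [div_eq_mul_inv] using this
  rcases eq_or_ne y 0 with rfl | hy
  · simp [arctanTrunc]
  -- The truncation equals y times the slope of arctan between 0 and y / (n + 1), which tends to
  -- arctan' 0 = 1.
  have hd : HasDerivAt Real.arctan 1 0 := by simpa using Real.hasDerivAt_arctan 0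
  rw [hasDerivAt_iff_tendsto_slope] at hd
  have h1 : Tendsto (fun n : ℕ => y / ((n : ℝ) + 1)) atTop (𝓝[≠] 0) :=
    tendsto_nhdsWithin_iff.2 ⟨h0, Eventually.of_forall fun n =>
      div_ne_zero hy (by positivity)⟩
  have h2 := (hd.comp h1).const_mul y
  rw [mul_one] at h2
  refine h2.congr fun n => ?_
  have hn : (n + 1 : ℝ) ≠ 0 := by positivity
  simp only [Function.comp, slope_def_field, Real.arctan_zero, sub_zero, arctanTrunc]
  field_simp

namespace ErrorStructure

variable {Ω : Type*} [MeasurableSpace Ω] {P : Measure Ω} [IsProbabilityMeasure P]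
  (S : ErrorStructure P)

/-! ### The energy form -/

/-- The bilinear form `𝔼[Γ[u, v]]`. -/
noncomputable def energyForm (u v : S.domain) : ℝ := L1.integral (S.Γ u v)

theorem energyForm_eq_integral (u v : S.domain) : S.energyForm u v = ∫ ω, S.Γ u v ω ∂P :=
  L1.integral_eq_integral _

theorem energyForm_nonneg (u : S.domain) : 0 ≤ S.energyForm u u := by
  rw [energyForm_eq_integral]
  exact integral_nonneg_of_ae (S.Γ_nonneg u)

theorem norm_Γ_self (u : S.domain) : ‖S.Γ u u‖ = S.energyForm u u := by
  rw [energyForm_eq_integral, L1.norm_eq_integral_norm]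
  refine integral_congr_ae ?_
  filter_upwards [S.Γ_nonneg u] with ω h
  exact Real.norm_of_nonneg h

theorem Γ_smul_add_smul (r s : ℝ) (u v : S.domain) :
    S.Γ (r • u + s • v) (r • u + s • v) =
      r ^ 2 • S.Γ u u + (2 * r * s) • S.Γ u v + s ^ 2 • S.Γ v v := by
  simp only [map_add, map_smul, LinearMap.add_apply, LinearMap.smul_apply, S.Γ_symm v u]
  module

theorem energyForm_smul_add_smul (r s : ℝ) (u v : S.domain) :
    S.energyForm (r • u + s • v) (r • u + s • v) =
      r ^ 2 * S.energyForm u u + 2 * r * s * S.energyForm u v + s ^ 2 * S.energyForm v v := by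
  simp only [energyForm, Γ_smul_add_smul, L1.integral_add, L1.integral_smul, smul_eq_mul]

/-- The Cauchy-Schwarz inequality for the carré du champ, in weighted form. -/
theorem two_mul_abs_Γ_le (u v : S.domain) {c : ℝ} (hc : 0 < c) :
    ∀ᵐ ω ∂P, 2 * |S.Γ u v ω| ≤ c * S.Γ u u ω + c⁻¹ * S.Γ v v ω := by
  -- The exceptional null set depends on the scalars, so c stays fixed and only s = ±1 is used; c is
  -- optimised after integration.
  have key : ∀ s : ℝ, ∀ᵐ ω ∂P,
      0 ≤ c ^ 2 * S.Γ u u ω + 2 * c * s * S.Γ u v ω + s ^ 2 * S.Γ v v ω := by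
    intro s
    have h := S.Γ_nonneg (c • u + s • v)
    rw [Γ_smul_add_smul] at h
    filter_upwards [h, Lp.coeFn_add (c ^ 2 • S.Γ u u + (2 * c * s) • S.Γ u v) (s ^ 2 • S.Γ v v),
      Lp.coeFn_add (c ^ 2 • S.Γ u u) ((2 * c * s) • S.Γ u v), Lp.coeFn_smul (c ^ 2) (S.Γ u u),
      Lp.coeFn_smul (2 * c * s) (S.Γ u v), Lp.coeFn_smul (s ^ 2) (S.Γ v v)]
      with ω h h1 h2 h3 h4 h5
    rw [h1, Pi.add_apply, h2, Pi.add_apply, h3, h4, h5] at h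
    simpa using h
  filter_upwards [key 1, key (-1)] with ω h1 h2
  have : 2 * c * |S.Γ u v ω| ≤ c ^ 2 * S.Γ u u ω + S.Γ v v ω := by
    rcases abs_cases (S.Γ u v ω) with ⟨h, _⟩ | ⟨h, _⟩ <;> rw [h] <;> linarith
  have h3 := mul_le_mul_of_nonneg_left this (inv_pos.2 hc).le
  have e1 : c⁻¹ * (2 * c * |S.Γ u v ω|) = 2 * |S.Γ u v ω| := by field_simp
  have e2 : c⁻¹ * (c ^ 2 * S.Γ u u ω + S.Γ v v ω) = c * S.Γ u u ω + c⁻¹ * S.Γ v v ω := by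
    field_simp
  rwa [e1, e2] at h3

/-- Integrating the weighted inequality and multiplying by c gives a quadratic in c that is
nonnegative for c > 0. For c ≤ 0 this is clear from the signs, so its discriminant is at most 0. -/
theorem norm_Γ_sq_le (u v : S.domain) :
    ‖S.Γ u v‖ ^ 2 ≤ S.energyForm u u * S.energyForm v v := by
  have key : ∀ c : ℝ, 0 < c →
      2 * ‖S.Γ u v‖ ≤ c * S.energyForm u u + c⁻¹ * S.energyForm v v := by
    intro c hc
    rw [L1.norm_eq_integral_norm, energyForm_eq_integral, energyForm_eq_integral,
      ← integral_const_mul, ← integral_const_mul, ← integral_const_mul,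
      ← integral_add ((L1.integrable_coeFn _).const_mul _) ((L1.integrable_coeFn _).const_mul _)]
    exact integral_mono_ae ((L1.integrable_coeFn _).norm.const_mul _)
      (((L1.integrable_coeFn _).const_mul _).add ((L1.integrable_coeFn _).const_mul _))
      (S.two_mul_abs_Γ_le u v hc)
  have := discrim_le_zero (a := S.energyForm u u) (b := -(2 * ‖S.Γ u v‖))
    (c := S.energyForm v v) fun c => by
      rcases le_or_gt c 0 with hc | hc
      · have h1 := S.energyForm_nonneg u
        have h2 := S.energyForm_nonneg v
        have h3 := mul_nonneg h1 (mul_self_nonneg c)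
        have h4 := mul_nonneg (norm_nonneg (S.Γ u v)) (neg_nonneg.2 hc)
        linarith
      · have h := mul_le_mul_of_nonneg_left (key c hc) hc.le
        have e : c * (c * S.energyForm u u + c⁻¹ * S.energyForm v v) =
            S.energyForm u u * (c * c) + S.energyForm v v := by field_simp
        rw [e] at h
        linarith
  rw [discrim] at this
  linarith

/-- `Γ[u_n] → Γ[u]` in `L¹` whenever `u_n → u` in energy. -/
theorem tendsto_Γ_self {u : ℕ → S.domain} {v : S.domain}
    (h : Tendsto (fun n => S.energyForm (v - u n) (v - u n)) atTop (𝓝 0)) :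
    Tendsto (fun n => S.Γ (u n) (u n)) atTop (𝓝 (S.Γ v v)) := by
  -- Expansion of u_n = v - (v - u_n); Cauchy-Schwarz disposes of the cross term.
  have e : ∀ n, S.Γ (u n) (u n) =
      S.Γ v v - (2 : ℝ) • S.Γ v (v - u n) + S.Γ (v - u n) (v - u n) := by
    intro n
    simp only [map_sub, LinearMap.sub_apply, S.Γ_symm (u n) v]
    module
  have h1 : Tendsto (fun n => S.Γ (v - u n) (v - u n)) atTop (𝓝 0) := by
    rw [tendsto_zero_iff_norm_tendsto_zero]
    simpa only [norm_Γ_self] using h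
  have h2 : Tendsto (fun n => S.Γ v (v - u n)) atTop (𝓝 0) := by
    rw [tendsto_zero_iff_norm_tendsto_zero]
    have hs : Tendsto (fun n => √(S.energyForm v v * S.energyForm (v - u n) (v - u n)))
        atTop (𝓝 0) := by
      simpa using (h.const_mul (S.energyForm v v)).sqrt
    exact squeeze_zero (fun _ => norm_nonneg _)
      (fun n => Real.le_sqrt_of_sq_le (S.norm_Γ_sq_le _ _)) hs
  simp_rw [e]
  simpa using ((h2.const_smul (2 : ℝ)).const_sub (S.Γ v v)).add h1

/-! ### Closedness -/

/-- The domain is closed under limits in `L²` of elements of bounded energy. -/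
theorem mem_domain_of_approx {u : Lp ℝ 2 P} {C : ℝ}
    (h : ∀ ε : ℝ, 0 < ε → ∃ v : S.domain, ‖(v : Lp ℝ 2 P) - u‖ ≤ ε ∧ S.energyForm v v ≤ C) :
    ∃ v : S.domain, (v : Lp ℝ 2 P) = u ∧ S.energyForm v v ≤ C := by
  have hinv : ∀ m n : ℕ, m ≤ n → 1 / ((n : ℝ) + 1) ≤ 1 / ((m : ℝ) + 1) := fun m n hmn =>
    one_div_le_one_div_of_le (by positivity) (by gcongr)
  -- Near-minimisers of the energy on shrinking convex balls around u will form a Cauchy sequence: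
  -- the infima `d n` increase and are bounded by C, hence converge.
  set K : ℕ → Set S.domain := fun n => {v | ‖(v : Lp ℝ 2 P) - u‖ ≤ 1 / ((n : ℝ) + 1)} with hK
  have hKanti : Antitone K := fun m n hmn v hv =>
    le_trans hv (hinv m n hmn)
  set d : ℕ → ℝ := fun n => sInf ((fun v => S.energyForm v v) '' K n) with hd
  have hbdd : ∀ n, BddBelow ((fun v => S.energyForm v v) '' K n) := fun n =>
    ⟨0, by rintro _ ⟨v, _, rfl⟩; exact S.energyForm_nonneg v⟩
  have hdle : ∀ n, ∀ v ∈ K n, d n ≤ S.energyForm v v := fun n v hv =>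
    csInf_le (hbdd n) ⟨v, hv, rfl⟩
  have hne : ∀ n, ∃ v ∈ K n, S.energyForm v v ≤ C := fun n =>
    h (1 / ((n : ℝ) + 1)) (by positivity)
  have hdC : ∀ n, d n ≤ C := fun n =>
    let ⟨v, hv, hC⟩ := hne n
    (hdle n v hv).trans hC
  have hmono : Monotone d := fun m n hmn =>
    csInf_le_csInf (hbdd m) (let ⟨v, hv, _⟩ := hne n; ⟨_, v, hv, rfl⟩)
      (Set.image_mono (hKanti hmn))
  have hsel : ∀ n : ℕ, ∃ v ∈ K n, S.energyForm v v < d n + 1 / ((n : ℝ) + 1) := fun n => by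
    obtain ⟨_, ⟨v, hv, rfl⟩, hlt⟩ := exists_lt_of_csInf_lt
      (s := (fun v => S.energyForm v v) '' K n) (b := d n + 1 / ((n : ℝ) + 1))
      (let ⟨v, hv, _⟩ := hne n; ⟨_, v, hv, rfl⟩)
      (lt_add_of_pos_right _ (by positivity))
    exact ⟨v, hv, hlt⟩
  choose w hwK hwE using hsel
  have hconv : ∀ N, ∀ a ∈ K N, ∀ b ∈ K N, (1 / 2 : ℝ) • a + (1 / 2 : ℝ) • b ∈ K N := by
    intro N a ha b hb
    have e : (((1 / 2 : ℝ) • a + (1 / 2 : ℝ) • b : S.domain) : Lp ℝ 2 P) - u =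
        (1 / 2 : ℝ) • ((a : Lp ℝ 2 P) - u) + (1 / 2 : ℝ) • ((b : Lp ℝ 2 P) - u) := by
      push_cast
      module
    change ‖_ - u‖ ≤ _
    rw [e]
    refine (norm_add_le _ _).trans ?_
    rw [norm_smul, norm_smul]
    have ha' : ‖(a : Lp ℝ 2 P) - u‖ ≤ 1 / ((N : ℝ) + 1) := ha
    have hb' : ‖(b : Lp ℝ 2 P) - u‖ ≤ 1 / ((N : ℝ) + 1) := hb
    norm_num at *
    linarith
  -- Parallelogram identity: the midpoint lies in `K N`, so its energy is at least `d N`. The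
  -- near-minimality errors of `w m` and `w n` add up to at most 4 / (N + 1).
  have hsub : ∀ N m n, N ≤ m → N ≤ n → S.energyForm (w m - w n) (w m - w n) ≤
      2 * (d m + d n - 2 * d N) + 4 / ((N : ℝ) + 1) := by
    intro N m n hm hn
    have h1 := hdle N _ (hconv N _ (hKanti hm (hwK m)) _ (hKanti hn (hwK n)))
    rw [energyForm_smul_add_smul] at h1
    have h2 : S.energyForm (w m - w n) (w m - w n) = S.energyForm (w m) (w m)
        - 2 * S.energyForm (w m) (w n) + S.energyForm (w n) (w n) := by
      have := S.energyForm_smul_add_smul 1 (-1) (w m) (w n)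
      rw [one_smul, neg_one_smul, ← sub_eq_add_neg] at this
      rw [this]
      ring
    have h3 := hinv N m hm
    have h4 := hinv N n hn
    have h5 := hwE m
    have h6 := hwE n
    have h7 : 4 / ((N : ℝ) + 1) = 4 * (1 / ((N : ℝ) + 1)) := by ring
    rw [h2, h7]
    linarith
  have hnorm : ∀ N m n, N ≤ m → N ≤ n → ‖w m - w n‖ ≤ 2 / ((N : ℝ) + 1) := by
    intro N m n hm hn
    have h1 : ‖(w m : Lp ℝ 2 P) - u‖ ≤ 1 / ((N : ℝ) + 1) := hKanti hm (hwK m)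
    have h2 : ‖(w n : Lp ℝ 2 P) - u‖ ≤ 1 / ((N : ℝ) + 1) := hKanti hn (hwK n)
    have h3 : ‖w m - w n‖ = ‖((w m : Lp ℝ 2 P) - u) - ((w n : Lp ℝ 2 P) - u)‖ := by
      rw [sub_sub_sub_cancel_right]
      rfl
    rw [h3]
    refine (norm_sub_le _ _).trans ?_
    have h7 : 2 / ((N : ℝ) + 1) = 2 * (1 / ((N : ℝ) + 1)) := by ring
    linarith
  have hD : Tendsto d atTop (𝓝 (⨆ n, d n)) :=
    tendsto_atTop_ciSup hmono ⟨C, by rintro _ ⟨n, rfl⟩; exact hdC n⟩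
  have hDle : ∀ n, d n ≤ ⨆ n, d n := fun n => hmono.ge_of_tendsto hD n
  have hone := tendsto_one_div_add_atTop_nhds_zero_nat (𝕜 := ℝ)
  obtain ⟨v, hv⟩ := S.complete w (by
    intro ε hε
    -- Replacing `d m` and `d n` by their supremum makes the bound depend on N alone.
    have hlim : Tendsto (fun N : ℕ => (2 * (1 / ((N : ℝ) + 1))) ^ 2 +
        (4 * ((⨆ n, d n) - d N) + 4 * (1 / ((N : ℝ) + 1)))) atTop (𝓝 0) := by
      have := ((hone.const_mul 2).pow 2).add
        (((hD.const_sub (⨆ n, d n)).const_mul 4).add (hone.const_mul 4))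
      simpa using this
    obtain ⟨N, hN⟩ := (hlim.eventually_lt_const hε).exists
    refine ⟨N, fun m hm n hn => lt_of_le_of_lt ?_ hN⟩
    rw [← energyForm_eq_integral]
    refine add_le_add (pow_le_pow_left₀ (norm_nonneg _) ?_ 2) ?_
    · exact (hnorm N m n hm hn).trans_eq (by ring)
    · refine (hsub N m n hm hn).trans ?_
      have h7 : 4 / ((N : ℝ) + 1) = 4 * (1 / ((N : ℝ) + 1)) := by ring
      linarith [hDle m, hDle n])
  simp_rw [← energyForm_eq_integral] at hv
  have hvn : Tendsto (fun n => ‖w n - v‖ ^ 2) atTop (𝓝 0) :=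
    squeeze_zero (fun _ => sq_nonneg _)
      (fun n => le_add_of_nonneg_right (S.energyForm_nonneg _)) hv
  have hve : Tendsto (fun n => S.energyForm (w n - v) (w n - v)) atTop (𝓝 0) :=
    squeeze_zero (fun _ => S.energyForm_nonneg _)
      (fun n => le_add_of_nonneg_left (sq_nonneg _)) hv
  refine ⟨v, ?_, ?_⟩
  · have h1 : Tendsto (fun n => (w n : Lp ℝ 2 P)) atTop (𝓝 v) := by
      rw [tendsto_iff_norm_sub_tendsto_zero]
      have := hvn.sqrt
      simpa using this
    have h2 : Tendsto (fun n => (w n : Lp ℝ 2 P)) atTop (𝓝 u) := by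
      rw [tendsto_iff_norm_sub_tendsto_zero]
      exact squeeze_zero (fun _ => norm_nonneg _) hwK hone
    exact tendsto_nhds_unique h1 h2
  · have h1 : Tendsto (fun n => ‖S.Γ (w n) (w n)‖) atTop (𝓝 ‖S.Γ v v‖) := by
      refine (S.tendsto_Γ_self (hve.congr fun n => ?_)).norm
      simp only [energyForm, ← neg_sub v (w n), map_neg, LinearMap.neg_apply, neg_neg]
    rw [norm_Γ_self] at h1
    refine le_of_tendsto_of_tendsto' h1 (by simpa only [add_zero] using hone.const_add C) fun n => ?_
    rw [norm_Γ_self]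
    linarith [hwE n, hdC n]

/-- Γ[F(u)] = F'(u)² Γ[u] ≤ Γ[u] because |F'| ≤ 1. -/
theorem exists_arctanTrunc (n : ℕ) (u : S.domain) :
    ∃ v : S.domain, ((v : Lp ℝ 2 P) : Ω → ℝ) =ᵐ[P] (fun ω => arctanTrunc n ((u : Lp ℝ 2 P) ω)) ∧
      S.energyForm v v ≤ S.energyForm u u := by
  obtain ⟨v, v', hv, hv', hΓ⟩ := S.chain_rule (arctanTrunc n) (arctanTrunc n)
    (contDiff_arctanTrunc n) (contDiff_arctanTrunc n) ⟨1, lipschitzWith_arctanTrunc n⟩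
    ⟨1, lipschitzWith_arctanTrunc n⟩ u u
  obtain rfl : v = v' := Subtype.ext (Lp.ext (hv.trans hv'.symm))
  refine ⟨v, hv, ?_⟩
  rw [energyForm_eq_integral, energyForm_eq_integral]
  refine integral_mono_ae (L1.integrable_coeFn _) (L1.integrable_coeFn _) ?_
  filter_upwards [hΓ, S.Γ_nonneg u] with ω h h0
  rw [h]
  refine mul_le_of_le_one_left h0 ?_
  rw [← abs_mul_abs_self]
  exact mul_le_one₀ (abs_deriv_arctanTrunc_le _ _) (abs_nonneg _) (abs_deriv_arctanTrunc_le _ _)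

/-- The domain is closed under almost sure limits in `L²` of elements of bounded energy. -/
theorem mem_domain_of_tendsto_ae {u : ℕ → S.domain} {v : Lp ℝ 2 P} {C : ℝ}
    (hC : ∀ n, S.energyForm (u n) (u n) ≤ C)
    (hlim : ∀ᵐ ω ∂P, Tendsto (fun n => (u n : Lp ℝ 2 P) ω) atTop (𝓝 (v ω))) :
    ∃ w : S.domain, (w : Lp ℝ 2 P) = v ∧ S.energyForm w w ≤ C := by
  have hmem : ∀ M : ℕ, MemLp (fun ω => arctanTrunc M (v ω)) 2 P := fun M =>
    (Lp.memLp v).mono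
      ((contDiff_arctanTrunc M).continuous.comp_aestronglyMeasurable (Lp.aestronglyMeasurable v))
      (Eventually.of_forall fun ω => abs_arctanTrunc_le M _)
  -- At a fixed level M the truncations are uniformly bounded, and constants are square integrable
  -- for a probability measure, so almost sure convergence becomes L² convergence.
  have h1 : ∀ M : ℕ, ∃ w : S.domain, (w : Lp ℝ 2 P) = (hmem M).toLp ∧ S.energyForm w w ≤ C := by
    intro M
    choose w hw hwE using fun n => S.exists_arctanTrunc M (u n)
    have ht : Tendsto (fun n => (w n : Lp ℝ 2 P)) atTop (𝓝 (hmem M).toLp) := by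
      refine tendsto_Lp_two_of_dominated (memLp_const (((M : ℝ) + 1) * (Real.pi / 2)))
        (fun n => ?_) ?_
      · filter_upwards [hw n] with ω h
        rw [h]
        exact abs_arctanTrunc_le_const _ _
      · filter_upwards [ae_all_iff.2 hw, hlim, (hmem M).coeFn_toLp] with ω h h' h''
        rw [h'']
        simp_rw [h]
        exact ((contDiff_arctanTrunc M).continuous.tendsto _).comp h'
    refine S.mem_domain_of_approx fun ε hε => ?_
    obtain ⟨n, hn⟩ := (((tendsto_iff_norm_sub_tendsto_zero.1 ht).eventually_lt_const hε)).exists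
    exact ⟨w n, hn.le, (hwE n).trans (hC n)⟩
  choose w hw hwE using h1
  -- Removal of the truncation: |v| itself dominates, since v ∈ L².
  have ht : Tendsto (fun M => (w M : Lp ℝ 2 P)) atTop (𝓝 v) := by
    refine tendsto_Lp_two_of_dominated (Lp.memLp v).abs (fun M => ?_) ?_
    · rw [hw]
      filter_upwards [(hmem M).coeFn_toLp] with ω h
      rw [h]
      exact abs_arctanTrunc_le _ _
    · filter_upwards [ae_all_iff.2 fun M => (hmem M).coeFn_toLp] with ω h
      simp_rw [hw, h]
      exact tendsto_arctanTrunc _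
  refine S.mem_domain_of_approx fun ε hε => ?_
  obtain ⟨n, hn⟩ := (((tendsto_iff_norm_sub_tendsto_zero.1 ht).eventually_lt_const hε)).exists
  exact ⟨w n, hn.le, hwE n⟩

end ErrorStructure

/-! ### The wavelet basis -/

namespace IsWaveletSystem

variable {φ ψ : ℝ → ℝ}

theorem measurable_dilate {η : ℝ → ℝ} (h : Measurable η) (i k : ℤ) : Measurable (dilate η i k) := by
  unfold dilate
  fun_prop

/-- A nonintegrable function has integral 0 by convention, so the normalisation to 1 forces square
integrability. -/
theorem memLp_dilate {η : ℝ → ℝ} (h : Measurable η) (i k : ℤ)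
    (h1 : ∫ y, dilate η i k y * dilate η i k y = 1) : MemLp (dilate η i k) 2 volume := by
  rw [memLp_two_iff_integrable_sq (measurable_dilate h i k).aestronglyMeasurable]
  by_contra hn
  simp_rw [← sq] at h1
  rw [integral_undef hn] at h1
  exact zero_ne_one h1

theorem measurable_wavelet (h : IsWaveletSystem φ ψ) (n : WaveletIndex) :
    Measurable (wavelet φ ψ n) := by
  rcases n with k | ⟨i, k⟩
  · exact measurable_dilate h.measurable_father _ _
  · exact measurable_dilate h.measurable_mother _ _

theorem bounded_wavelet (h : IsWaveletSystem φ ψ) (n : WaveletIndex) :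
    ∃ C, ∀ y, |wavelet φ ψ n y| ≤ C := by
  have key : ∀ η : ℝ → ℝ, (∃ C, ∀ y, |η y| ≤ C) → ∀ i k : ℤ, ∃ C, ∀ y, |dilate η i k y| ≤ C := by
    rintro η ⟨C, hC⟩ i k
    refine ⟨|(2 : ℝ) ^ ((i : ℝ) / 2)| * C, fun y => ?_⟩
    rw [dilate, abs_mul]
    gcongr
    exact hC _
  rcases n with k | ⟨i, k⟩
  · exact key _ h.bounded_father _ _
  · exact key _ h.bounded_mother _ _

theorem memLp_wavelet (h : IsWaveletSystem φ ψ) (n : WaveletIndex) :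
    MemLp (wavelet φ ψ n) 2 volume := by
  rcases n with k | ⟨i, k⟩
  · exact memLp_dilate h.measurable_father _ _ (by simp [h.orthonormal_father])
  · exact memLp_dilate h.measurable_mother _ _ (by simp [h.orthonormal_mother])

/-- The wavelets as elements of `L²(ℝ)`. -/
noncomputable def waveletLp (h : IsWaveletSystem φ ψ) (n : WaveletIndex) :
    Lp ℝ 2 (volume : Measure ℝ) := (h.memLp_wavelet n).toLp

theorem coeFn_waveletLp (h : IsWaveletSystem φ ψ) (n : WaveletIndex) :
    (h.waveletLp n : ℝ → ℝ) =ᵐ[volume] wavelet φ ψ n := (h.memLp_wavelet n).coeFn_toLp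

theorem inner_waveletLp (h : IsWaveletSystem φ ψ) (n : WaveletIndex) {f : ℝ → ℝ}
    (hf : MemLp f 2 volume) :
    inner ℝ (h.waveletLp n) hf.toLp = ∫ y, f y * wavelet φ ψ n y := by
  rw [L2.inner_def]
  refine integral_congr_ae ?_
  filter_upwards [h.coeFn_waveletLp n, hf.coeFn_toLp] with y h1 h2
  simp [h1, h2]

theorem waveletLp_inl_mem (h : IsWaveletSystem φ ψ) (k : ℤ) :
    h.waveletLp (Sum.inl k) ∈ scaleSpace φ 0 :=
  Submodule.le_topologicalClosure _ (Submodule.subset_span ⟨k, h.coeFn_waveletLp _⟩)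

theorem waveletLp_inr_mem (h : IsWaveletSystem φ ψ) (i : ℕ) (k : ℤ) :
    h.waveletLp (Sum.inr (i, k)) ∈ scaleSpace ψ i :=
  Submodule.le_topologicalClosure _ (Submodule.subset_span ⟨k, h.coeFn_waveletLp _⟩)

theorem monotone_scaleSpace (h : IsWaveletSystem φ ψ) : Monotone (scaleSpace φ) :=
  monotone_int_of_le_succ h.nested

/-- Across scales i < j, the wavelet ψ_{i,k} lies in V_{i+1} ⊆ V_j while ψ_{j,l} is orthogonal to
V_j. The father wavelets lie in V_0 ⊆ V_j. -/
theorem orthonormal_waveletLp (h : IsWaveletSystem φ ψ) : Orthonormal ℝ h.waveletLp := by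
  have hperp : ∀ (i : ℕ) (k : ℤ), h.waveletLp (Sum.inr (i, k)) ∈ (scaleSpace φ i)ᗮ := fun i k => by
    have := h.waveletLp_inr_mem i k
    rw [h.scaleSpace_mother] at this
    exact this.1
  have hmem : ∀ (i j : ℕ) (k : ℤ), i < j →
      h.waveletLp (Sum.inr (i, k)) ∈ scaleSpace φ j := fun i j k hij => by
    have := h.waveletLp_inr_mem i k
    rw [h.scaleSpace_mother] at this
    exact h.monotone_scaleSpace (by exact_mod_cast hij) this.2
  have hmem0 : ∀ (j : ℕ) (k : ℤ), h.waveletLp (Sum.inl k) ∈ scaleSpace φ j := fun j k =>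
    h.monotone_scaleSpace (by positivity) (h.waveletLp_inl_mem k)
  rw [orthonormal_iff_ite]
  rintro (k | ⟨i, k⟩) (l | ⟨j, l⟩)
  · change inner ℝ _ (h.memLp_wavelet _).toLp = _
    rw [inner_waveletLp]
    simp_rw [mul_comm]
    simpa [wavelet] using h.orthonormal_father k l
  · simpa using (Submodule.mem_orthogonal _ _).1 (hperp j l) _ (hmem0 j k)
  · simpa using (Submodule.mem_orthogonal' _ _).1 (hperp i k) _ (hmem0 i l)
  · rcases lt_trichotomy i j with hij | rfl | hij
    · simpa [hij.ne] using (Submodule.mem_orthogonal _ _).1 (hperp j l) _ (hmem i j k hij)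
    · change inner ℝ _ (h.memLp_wavelet _).toLp = _
      rw [inner_waveletLp]
      simp_rw [mul_comm]
      simpa [wavelet] using h.orthonormal_mother i k l
    · simpa [hij.ne'] using (Submodule.mem_orthogonal' _ _).1 (hperp i k) _ (hmem j i l hij)

/-- Induction on V_{i+1} = V_i ⊕ W_i; completeness of V_i supplies the orthogonal projection. -/
theorem scaleSpace_le_closure_span (h : IsWaveletSystem φ ψ) (i : ℕ) :
    scaleSpace φ i ≤ (Submodule.span ℝ (Set.range h.waveletLp)).topologicalClosure := by
  induction i with
  | zero =>
    refine Submodule.topologicalClosure_mono (Submodule.span_mono ?_)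
    rintro u ⟨k, hk⟩
    exact ⟨Sum.inl k, Lp.ext ((h.coeFn_waveletLp _).trans hk.symm)⟩
  | succ i ih =>
    have : CompleteSpace (scaleSpace φ i) :=
      (Submodule.isClosed_topologicalClosure _).completeSpace_coe
    push_cast
    rw [← Submodule.sup_orthogonal_inf_of_hasOrthogonalProjection (h.nested i),
      ← h.scaleSpace_mother]
    refine sup_le ih (Submodule.topologicalClosure_mono (Submodule.span_mono ?_))
    rintro u ⟨k, hk⟩
    exact ⟨Sum.inr (i, k), Lp.ext ((h.coeFn_waveletLp _).trans hk.symm)⟩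

theorem top_le_closure_span (h : IsWaveletSystem φ ψ) :
    ⊤ ≤ (Submodule.span ℝ (Set.range h.waveletLp)).topologicalClosure := by
  intro u _
  have hsub : (⋃ i : ℤ, (scaleSpace φ i : Set (Lp ℝ 2 (volume : Measure ℝ)))) ⊆
      (Submodule.span ℝ (Set.range h.waveletLp)).topologicalClosure :=
    Set.iUnion_subset fun i => (h.monotone_scaleSpace (Int.self_le_toNat i)).trans
      (h.scaleSpace_le_closure_span i.toNat)
  exact closure_minimal hsub (Submodule.isClosed_topologicalClosure _) (h.dense_iUnion u)

theorem hasSum_waveletLp (h : IsWaveletSystem φ ψ) {f : ℝ → ℝ} (hf : MemLp f 2 volume) :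
    HasSum (fun n => (∫ y, f y * wavelet φ ψ n y) • h.waveletLp n) hf.toLp := by
  have := (HilbertBasis.mk h.orthonormal_waveletLp h.top_le_closure_span).hasSum_repr hf.toLp
  simpa [HilbertBasis.repr_apply_apply, inner_waveletLp] using this

end IsWaveletSystem

/-! ### The solution operator at a point -/

section Solution

variable {Ω' : Type*} [MeasurableSpace Ω'] {W : Measure Ω'} {X : ℝ → Ω' → ℝ}

/-- Composition with `X_0`, as a linear map from `L²(ℝ)` to `L¹(W)`. -/
noncomputable def SolvableInL2.compMap (h : SolvableInL2 W X) :
    Lp ℝ 2 (volume : Measure ℝ) →ₗ[ℝ] Lp ℝ 1 W where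
  toFun g := (h.2 g (Lp.memLp g)).toL1
  map_add' g₁ g₂ := by
    rw [← Integrable.toL1_add]
    exact (Integrable.toL1_eq_toL1_iff _ _ _ _).2 (h.1 _ _ (Lp.coeFn_add g₁ g₂))
  map_smul' c g := by
    rw [RingHom.id_apply, ← Integrable.toL1_smul]
    exact (Integrable.toL1_eq_toL1_iff _ _ _ _).2 (h.1 _ _ (Lp.coeFn_smul c g))

theorem SolvableInL2.coeFn_compMap (h : SolvableInL2 W X) (g : Lp ℝ 2 (volume : Measure ℝ)) :
    (h.compMap g : Ω' → ℝ) =ᵐ[W] fun ω => g (X 0 ω) :=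
  Integrable.coeFn_toL1 (h.2 g (Lp.memLp g))

/-- Independence of the representative, applied to the indicator of the failure set of p, says that
X_0 almost surely avoids Lebesgue null sets. -/
theorem SolvableInL2.ae_comp (h : SolvableInL2 W X) {p : ℝ → Prop} (hp : ∀ᵐ y, p y) :
    ∀ᵐ ω ∂W, p (X 0 ω) := by
  classical
  have := h.1 (fun y => if p y then 0 else 1) 0 (by filter_upwards [hp] with y hy; simp [hy])
  filter_upwards [this] with ω hω
  by_contra hn
  simp [hn] at hω

/-- Closed graph theorem. Along a common subsequence both limits hold almost everywhere, and
`ae_comp` transports the one on ℝ to X_0. No bound on a density of X_0 is needed. -/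
theorem SolvableInL2.continuous_compMap (h : SolvableInL2 W X) : Continuous h.compMap := by
  refine LinearMap.continuous_of_seq_closed_graph _ fun u g y hu hy => ?_
  obtain ⟨ns, hns, h1⟩ := (tendstoInMeasure_of_tendsto_Lp hu).exists_seq_tendsto_ae
  obtain ⟨ms, hms, h2⟩ := (tendstoInMeasure_of_tendsto_Lp
    (hy.comp hns.tendsto_atTop)).exists_seq_tendsto_ae
  refine Lp.ext ?_
  filter_upwards [h2, h.ae_comp h1, h.coeFn_compMap g,
    ae_all_iff.2 fun n => h.coeFn_compMap (u n)] with ω h2 h1 h3 h4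
  rw [h3]
  refine tendsto_nhds_unique h2 ((h1.comp hms.tendsto_atTop).congr fun n => ?_)
  simp [h4]

theorem SolvableInL2.integral_compMap (h : SolvableInL2 W X) {f : ℝ → ℝ}
    (hf : MemLp f 2 volume) : L1.integral (h.compMap hf.toLp) = lpdeSolution W X f := by
  rw [L1.integral_eq_integral, lpdeSolution]
  exact integral_congr_ae ((h.coeFn_compMap _).trans (h.1 _ _ hf.coeFn_toLp))

/-- The expansion of the solution in diffusionlets. -/
theorem hasSum_lpdeSolution {φ ψ : ℝ → ℝ} (hφψ : IsWaveletSystem φ ψ) (h : SolvableInL2 W X)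
    {f : ℝ → ℝ} (hf : MemLp f 2 volume) :
    HasSum (fun n => (∫ y, f y * wavelet φ ψ n y) * diffusionlet W X φ ψ n)
      (lpdeSolution W X f) := by
  have h1 := (hφψ.hasSum_waveletLp hf).map h.compMap h.continuous_compMap
  have h2 := h1.mapL (L1.integralCLM (α := Ω') (E := ℝ) (μ := W))
  have e : ∀ g : Lp ℝ 1 W, L1.integralCLM g = L1.integral g := fun g => by
    rw [L1.integral_eq]
  simp only [e, h.integral_compMap] at h2
  refine h2.congr_fun fun n => ?_
  simp only [Function.comp, map_smul, L1.integral_smul, smul_eq_mul]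
  rw [IsWaveletSystem.waveletLp, h.integral_compMap, diffusionlet]

end Solution

/-! ### Expansions with uncorrelated coefficients -/

namespace ErrorStructure

variable {Ω : Type*} [MeasurableSpace Ω] {P : Measure Ω} [IsProbabilityMeasure P]
  (S : ErrorStructure P)

theorem coeFn_sum_smul {ι : Type*} (a : ι → S.domain) (d : ι → ℝ) (A : Finset ι) :
    (((∑ n ∈ A, d n • a n : S.domain) : Lp ℝ 2 P) : Ω → ℝ) =ᵐ[P]
      fun ω => ∑ n ∈ A, (a n : Lp ℝ 2 P) ω * d n := by
  classical
  induction A using Finset.induction_on with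
  | empty => exact Eventually.of_forall fun ω => by simp
  | insert m A hm ih =>
    filter_upwards [ih, Lp.coeFn_add ((d m • a m : S.domain) : Lp ℝ 2 P)
      ((∑ n ∈ A, d n • a n : S.domain) : Lp ℝ 2 P), Lp.coeFn_smul (d m) (a m : Lp ℝ 2 P)]
      with ω h1 h2 h3
    rw [Finset.sum_insert hm, Finset.sum_insert hm, Submodule.coe_add, h2, Pi.add_apply, h1,
      Submodule.coe_smul, h3, Pi.smul_apply, smul_eq_mul, mul_comm]

theorem Γ_sum_smul_self {ι : Type*} {a : ι → S.domain} {γ : ι → ℝ}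
    (h_uncorrelated : ∀ m n, m ≠ n → (S.Γ (a m) (a n) : Ω → ℝ) =ᵐ[P] 0)
    (h_proportional : ∀ n,
      (S.Γ (a n) (a n) : Ω → ℝ) =ᵐ[P] fun ω => γ n * ((a n : Lp ℝ 2 P) ω) ^ 2)
    (d : ι → ℝ) (A : Finset ι) :
    (S.Γ (∑ n ∈ A, d n • a n) (∑ n ∈ A, d n • a n) : Ω → ℝ) =ᵐ[P]
      fun ω => ∑ n ∈ A, γ n * ((a n : Lp ℝ 2 P) ω) ^ 2 * d n ^ 2 := by
  classical
  have hzero : ∀ m n, m ≠ n → S.Γ (a m) (a n) = 0 := fun m n hmn =>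
    Lp.ext ((h_uncorrelated m n hmn).trans (Lp.coeFn_zero ℝ 1 P).symm)
  induction A using Finset.induction_on with
  | empty => exact Eventually.of_forall fun ω => by simp
  | insert m A hm ih =>
    have hcross : S.Γ (a m) (∑ n ∈ A, d n • a n) = 0 := by
      rw [map_sum]
      refine Finset.sum_eq_zero fun n hn => ?_
      rw [map_smul, hzero m n (fun h => hm (h ▸ hn)), smul_zero]
    have e := S.Γ_smul_add_smul (d m) 1 (a m) (∑ n ∈ A, d n • a n)
    rw [hcross, smul_zero, add_zero, one_smul, one_pow, one_smul] at e
    rw [Finset.sum_insert hm, e]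
    filter_upwards [ih, Lp.coeFn_add (d m ^ 2 • S.Γ (a m) (a m))
      (S.Γ (∑ n ∈ A, d n • a n) (∑ n ∈ A, d n • a n)),
      Lp.coeFn_smul (d m ^ 2) (S.Γ (a m) (a m)), h_proportional m] with ω h1 h2 h3 h4
    rw [h2, Pi.add_apply, h1, h3, Pi.smul_apply, h4, Finset.sum_insert hm, smul_eq_mul, mul_comm]

theorem energyForm_sum_smul_self {ι : Type*} {a : ι → S.domain} {γ : ι → ℝ}
    (h_uncorrelated : ∀ m n, m ≠ n → (S.Γ (a m) (a n) : Ω → ℝ) =ᵐ[P] 0)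
    (h_proportional : ∀ n,
      (S.Γ (a n) (a n) : Ω → ℝ) =ᵐ[P] fun ω => γ n * ((a n : Lp ℝ 2 P) ω) ^ 2)
    (d : ι → ℝ) (A : Finset ι) :
    S.energyForm (∑ n ∈ A, d n • a n) (∑ n ∈ A, d n • a n) =
      ∑ n ∈ A, γ n * (∫ ω, ((a n : Lp ℝ 2 P) ω) ^ 2 ∂P) * d n ^ 2 := by
  rw [energyForm_eq_integral,
    integral_congr_ae (S.Γ_sum_smul_self h_uncorrelated h_proportional d A), integral_finsetSum]
  · simp_rw [integral_mul_const, integral_const_mul]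
  · exact fun n _ => ((Lp.memLp _).integrable_sq.const_mul _).mul_const _

/-- γ itself may be negative when a vanishes; the sign comes from positivity of Γ. -/
theorem ae_nonneg_of_proportional {a : S.domain} {γ : ℝ}
    (h : (S.Γ a a : Ω → ℝ) =ᵐ[P] fun ω => γ * ((a : Lp ℝ 2 P) ω) ^ 2) (d : ℝ) :
    ∀ᵐ ω ∂P, 0 ≤ γ * ((a : Lp ℝ 2 P) ω) ^ 2 * d ^ 2 := by
  filter_upwards [h, S.Γ_nonneg a] with ω h1 h2
  rw [← h1]
  exact mul_nonneg h2 (sq_nonneg _)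

/-- An almost surely convergent series of uncorrelated terms with summable energies belongs to the
domain as soon as its sum `v` is in `L²`. -/
theorem exists_energyForm_le_tsum {a : ℕ → S.domain} {γ : ℕ → ℝ}
    (h_uncorrelated : ∀ m n, m ≠ n → (S.Γ (a m) (a n) : Ω → ℝ) =ᵐ[P] 0)
    (h_proportional : ∀ n,
      (S.Γ (a n) (a n) : Ω → ℝ) =ᵐ[P] fun ω => γ n * ((a n : Lp ℝ 2 P) ω) ^ 2)
    {d : ℕ → ℝ} {v : Lp ℝ 2 P}
    (hv : ∀ᵐ ω ∂P, HasSum (fun n => (a n : Lp ℝ 2 P) ω * d n) (v ω))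
    (hsum : Summable fun n => γ n * (∫ ω, ((a n : Lp ℝ 2 P) ω) ^ 2 ∂P) * d n ^ 2) :
    ∃ w : S.domain, (w : Lp ℝ 2 P) = v ∧
      S.energyForm w w ≤ ∑' n, γ n * (∫ ω, ((a n : Lp ℝ 2 P) ω) ^ 2 ∂P) * d n ^ 2 := by
  have hpos : ∀ n, 0 ≤ γ n * (∫ ω, ((a n : Lp ℝ 2 P) ω) ^ 2 ∂P) * d n ^ 2 := fun n => by
    have := integral_nonneg_of_ae (S.ae_nonneg_of_proportional (h_proportional n) (d n))
    rwa [integral_mul_const, integral_const_mul] at this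
  refine S.mem_domain_of_tendsto_ae (u := fun N => ∑ n ∈ Finset.range N, d n • a n)
    (fun N => ?_) ?_
  · rw [S.energyForm_sum_smul_self h_uncorrelated h_proportional]
    exact hsum.sum_le_tsum _ fun n _ => hpos n
  · filter_upwards [hv, ae_all_iff.2 fun N => S.coeFn_sum_smul a d (Finset.range N)] with ω h1 h2
    exact h1.tendsto_sum_nat.congr fun N => (h2 N).symm

/-- An almost surely convergent series of uncorrelated terms with summable energies can be
evaluated under the carré du champ term by term, as soon as its sum `v` is in `L²`. -/
theorem exists_hasSum_Γ {a : ℕ → S.domain} {γ : ℕ → ℝ}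
    (h_uncorrelated : ∀ m n, m ≠ n → (S.Γ (a m) (a n) : Ω → ℝ) =ᵐ[P] 0)
    (h_proportional : ∀ n,
      (S.Γ (a n) (a n) : Ω → ℝ) =ᵐ[P] fun ω => γ n * ((a n : Lp ℝ 2 P) ω) ^ 2)
    {d : ℕ → ℝ} {v : Lp ℝ 2 P}
    (hv : ∀ᵐ ω ∂P, HasSum (fun n => (a n : Lp ℝ 2 P) ω * d n) (v ω))
    (hsum : Summable fun n => γ n * (∫ ω, ((a n : Lp ℝ 2 P) ω) ^ 2 ∂P) * d n ^ 2) :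
    ∃ w : S.domain, (w : Lp ℝ 2 P) = v ∧
      ∀ᵐ ω ∂P, HasSum (fun n => γ n * ((a n : Lp ℝ 2 P) ω) ^ 2 * d n ^ 2) (S.Γ w w ω) := by
  obtain ⟨w, rfl, -⟩ := S.exists_energyForm_le_tsum h_uncorrelated h_proportional hv hsum
  refine ⟨w, rfl, ?_⟩
  -- The energy bound, applied to the series shifted by N, controls the remainder.
  have htail : ∀ N, S.energyForm (w - ∑ n ∈ Finset.range N, d n • a n)
      (w - ∑ n ∈ Finset.range N, d n • a n) ≤
        ∑' n, γ (n + N) * (∫ ω, ((a (n + N) : Lp ℝ 2 P) ω) ^ 2 ∂P) * d (n + N) ^ 2 := by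
    intro N
    obtain ⟨w', hw', hE⟩ := S.exists_energyForm_le_tsum (a := fun n => a (n + N))
      (γ := fun n => γ (n + N)) (d := fun n => d (n + N))
      (v := (w : Lp ℝ 2 P) - (∑ n ∈ Finset.range N, d n • a n : S.domain))
      (fun m n hmn => h_uncorrelated _ _ (by omega)) (fun n => h_proportional _) (by
        filter_upwards [hv, S.coeFn_sum_smul a d (Finset.range N), Lp.coeFn_sub (w : Lp ℝ 2 P)
          ((∑ n ∈ Finset.range N, d n • a n : S.domain) : Lp ℝ 2 P)] with ω h1 h2 h3
        rw [h3, Pi.sub_apply, h2]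
        exact (hasSum_nat_add_iff' N).2 h1) ((summable_nat_add_iff N).2 hsum)
    obtain rfl : w' = w - ∑ n ∈ Finset.range N, d n • a n :=
      Subtype.ext (hw'.trans (AddSubgroupClass.coe_sub w _).symm)
    exact hE
  have hΓ : Tendsto (fun N => S.Γ (∑ n ∈ Finset.range N, d n • a n)
      (∑ n ∈ Finset.range N, d n • a n)) atTop (𝓝 (S.Γ w w)) :=
    S.tendsto_Γ_self (squeeze_zero (fun _ => S.energyForm_nonneg _) htail
      (tendsto_sum_nat_add fun n => γ n * (∫ ω, ((a n : Lp ℝ 2 P) ω) ^ 2 ∂P) * d n ^ 2))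
  obtain ⟨ns, hns, h1⟩ := (tendstoInMeasure_of_tendsto_Lp hΓ).exists_seq_tendsto_ae
  filter_upwards [h1,
    ae_all_iff.2 fun n => S.ae_nonneg_of_proportional (h_proportional n) (d n),
    ae_all_iff.2 fun N => S.Γ_sum_smul_self h_uncorrelated h_proportional d (Finset.range N)]
    with ω h1 h2 h3
  rw [hasSum_iff_tendsto_nat_of_nonneg h2]
  -- L¹ convergence gives almost sure convergence only along a subsequence; monotonicity extends it
  -- to all partial sums.
  have hmono : Monotone fun N => ∑ n ∈ Finset.range N,
      γ n * ((a n : Lp ℝ 2 P) ω) ^ 2 * d n ^ 2 := fun m n hmn =>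
    Finset.sum_le_sum_of_subset_of_nonneg (Finset.range_mono hmn) fun _ _ _ => h2 _
  exact (tendsto_iff_tendsto_subseq_of_monotone hmono hns.tendsto_atTop).2
    (h1.congr fun k => h3 (ns k))

end ErrorStructure

/-- The solution of a truncated expansion. -/
theorem lpdeSolution_sum {Ω' : Type*} [MeasurableSpace Ω'] {W : Measure Ω'} [IsFiniteMeasure W]
    {X : ℝ → Ω' → ℝ} (hX : Measurable (X 0)) {φ ψ : ℝ → ℝ} (hφψ : IsWaveletSystem φ ψ)
    (A : Finset WaveletIndex) (c : WaveletIndex → ℝ) :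
    lpdeSolution W X (fun y => ∑ n ∈ A, c n * wavelet φ ψ n y) =
      ∑ n ∈ A, c n * diffusionlet W X φ ψ n := by
  simp only [lpdeSolution, diffusionlet]
  rw [integral_finsetSum]
  · simp_rw [integral_const_mul]
  · intro n _
    obtain ⟨C, hC⟩ := hφψ.bounded_wavelet n
    -- Bounded wavelets are integrable under any law of X_0, so `SolvableInL2` is not required.
    exact (Integrable.of_bound ((hφψ.measurable_wavelet n).comp hX).aestronglyMeasurable C
      (Eventually.of_forall fun ω => hC _)).const_mul _

theorem mainTheorem3
    {φ ψ : ℝ → ℝ} (hφψ : IsWaveletSystem φ ψ)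
    (E : LPDE) {t x : ℝ} (ht : t ≤ 0)
    {Ω' : Type*} [MeasurableSpace Ω'] (W : Measure Ω') (X : ℝ → Ω' → ℝ)
    (hX : IsDiffusionFrom E t x W X)
    {Ω : Type*} [MeasurableSpace Ω] (P : Measure Ω) [IsProbabilityMeasure P]
    (S : ErrorStructure P)
    (a : WaveletIndex → S.domain) (γ : WaveletIndex → ℝ)
    (h_uncorrelated : ∀ m n, m ≠ n → (S.Γ (a m) (a n) : Ω → ℝ) =ᵐ[P] 0)
    (h_proportional : ∀ n,
      (S.Γ (a n) (a n) : Ω → ℝ) =ᵐ[P] fun ω => γ n * ((a n : Lp ℝ 2 P) ω) ^ 2) :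
    -- a random terminal condition in `L²(ℝ)` with wavelet coefficients `a`
    (∀ f : Ω → ℝ → ℝ,
      (∀ᵐ ω ∂P, MemLp (f ω) 2 volume) →
      (∀ n, ((a n : Lp ℝ 2 P) : Ω → ℝ) =ᵐ[P] fun ω => ∫ y, f ω y * wavelet φ ψ n y) →
      SolvableInL2 W X →
      MemLp (fun ω => lpdeSolution W X (f ω)) 2 P →
      Summable (fun n => γ n * (∫ ω, ((a n : Lp ℝ 2 P) ω) ^ 2 ∂P) *
        (diffusionlet W X φ ψ n) ^ 2) →
      ∃ Q : S.domain,
        ((Q : Lp ℝ 2 P) : Ω → ℝ) =ᵐ[P] (fun ω => lpdeSolution W X (f ω)) ∧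
        ∀ᵐ ω ∂P,
          Summable (fun k : ℤ => γ (Sum.inl k) * ((a (Sum.inl k) : Lp ℝ 2 P) ω) ^ 2 *
            (diffusionlet W X φ ψ (Sum.inl k)) ^ 2) ∧
          Summable (fun p : ℕ × ℤ => γ (Sum.inr p) * ((a (Sum.inr p) : Lp ℝ 2 P) ω) ^ 2 *
            (diffusionlet W X φ ψ (Sum.inr p)) ^ 2) ∧
          S.Γ Q Q ω =
            (∑' k : ℤ, γ (Sum.inl k) * ((a (Sum.inl k) : Lp ℝ 2 P) ω) ^ 2 *
              (diffusionlet W X φ ψ (Sum.inl k)) ^ 2) +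
            ∑' (i : ℕ) (k : ℤ), γ (Sum.inr (i, k)) * ((a (Sum.inr (i, k)) : Lp ℝ 2 P) ω) ^ 2 *
              (diffusionlet W X φ ψ (Sum.inr (i, k))) ^ 2) ∧
    -- a truncated wavelet expansion
    (∀ A : Finset WaveletIndex,
      ∃ Q : S.domain,
        ((Q : Lp ℝ 2 P) : Ω → ℝ) =ᵐ[P]
          (fun ω => lpdeSolution W X
            (fun y => ∑ n ∈ A, (a n : Lp ℝ 2 P) ω * wavelet φ ψ n y)) ∧
        (S.Γ Q Q : Ω → ℝ) =ᵐ[P]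
          (fun ω => ∑ n ∈ A, γ n * ((a n : Lp ℝ 2 P) ω) ^ 2 *
            (diffusionlet W X φ ψ n) ^ 2)) := by
  have := hX.isProbabilityMeasure
  refine ⟨fun f hf ha hsol hQ hsum => ?_, fun A => ?_⟩
  -- Any enumeration serves, since `HasSum` is unconditional; the result is transported back and
  -- then split by scale.
  · obtain ⟨e⟩ : Nonempty (ℕ ≃ WaveletIndex) := ⟨(Denumerable.eqv WaveletIndex).symm⟩
    have hexp : ∀ᵐ ω ∂P, HasSum
        (fun n => (a (e n) : Lp ℝ 2 P) ω * diffusionlet W X φ ψ (e n)) (hQ.toLp _ ω) := by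
      filter_upwards [hf, ae_all_iff.2 ha, hQ.coeFn_toLp] with ω h1 h2 h3
      rw [h3]
      simp_rw [h2]
      exact e.hasSum_iff.2 (hasSum_lpdeSolution hφψ hsol h1)
    obtain ⟨Q, hQ', hΓ⟩ := S.exists_hasSum_Γ (a := fun n => a (e n)) (γ := fun n => γ (e n))
      (fun m n hmn => h_uncorrelated _ _ (e.injective.ne hmn)) (fun n => h_proportional _)
      hexp (e.summable_iff.2 hsum)
    refine ⟨Q, hQ' ▸ hQ.coeFn_toLp, ?_⟩
    filter_upwards [hΓ] with ω h
    have h' : HasSum (fun n => γ n * ((a n : Lp ℝ 2 P) ω) ^ 2 * diffusionlet W X φ ψ n ^ 2)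
        (S.Γ Q Q ω) := e.hasSum_iff.1 h
    have hl := h'.summable.comp_injective (Sum.inl_injective (α := ℤ) (β := ℕ × ℤ))
    have hr := h'.summable.comp_injective (Sum.inr_injective (α := ℤ) (β := ℕ × ℤ))
    refine ⟨hl, hr, ?_⟩
    rw [← h'.tsum_eq, hl.tsum_sum hr]
    exact congrArg _ hr.tsum_prod
  · refine ⟨∑ n ∈ A, diffusionlet W X φ ψ n • a n, ?_,
      S.Γ_sum_smul_self h_uncorrelated h_proportional _ A⟩
    simp_rw [lpdeSolution_sum (hX.measurable 0 ⟨ht, le_rfl⟩) hφψ]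
    exact S.coeFn_sum_smul a _ A
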